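/- Let $X$ and $F$ be measurable spaces and let $\ell_0 : X\times F\to[0,1]$ be measurable with respect to the product $\sigma$-algebra. For a class $G$ of functions $X\to[0,1]$ and $\alpha>0$, let $\mathrm{fat}_\alpha(G)\in\{0,1,2,\dots\}\cup\{\infty\}$ be the supremum of the integers $d\ge 0$ for which there are $x_1,\dots,x_d\in X$ and $s_1,\dots,s_d\in[0,1]$ such that for every $\varepsilon\in\{-1,1\}^d$ some $g\in G$ satisfies $\varepsilon_i\,(g(x_i)-s_i)\ge \alpha/2$ for all $i$. Assume that $(X,F,\ell_0)$ is a Glivenko--Cantelli (GC) game, i.e. that $\mathrm{fat}_\alpha(\{x\mapsto \ell_0(x,f): f\in F\})<\infty$ for every $\alpha>0$. For $\alpha>2\beta>0$, the game contains infinitely many ordered thresholds with margin $\alpha$ and tightness $\beta$ if there are $x_1,x_2,\dots\in X$, $f_1,f_2,\dots\in F$ and $u,u'\in[0,1]$ with $u'>u$ and $|u-u'|\ge\alpha$ such that $|\ell_0(x_j,f_i)-u|\le\beta$ whenever $i\le j$ and $|\ell_0(x_j,f_i)-u'|\le\beta$ whenever $i>j$. For $X'\subset X$ and $F'\subset F$,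 equipped with the trace $\sigma$-algebras, let $\Delta(X')$ and $\Delta(F')$ denote the sets of all probability measures on $X'$ and on $F'$. Let $C_0>2$ be any real number. Then $$\inf_{P_X\in\Delta(X')}\ \sup_{P_F\in\Delta(F')}\ \mathbb{E}_{(x,f)\sim P_X\times P_F}[\ell_0(x,f)]\;=\;\sup_{P_F\in\Delta(F')}\ \inf_{P_X\in\Delta(X')}\ \mathbb{E}_{(x,f)\sim P_X\times P_F}[\ell_0(x,f)]$$ holds for all nonempty $X'\subset X$ and $F'\subset F$ if and only if, for every $\alpha>0$, the game $(X,F,\ell_0)$ does not contain infinitely many ordered thresholds with margin $\alpha$ and tightness $\alpha/C_0$. -/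

import Mathlib

open MeasureTheory

namespace MinimaxGame

/-- The points `x 0, …, x (d - 1)` are `α`-shattered by the class `G` with witness `s`: for every
sign pattern there is `g ∈ G` which is at least `α / 2` above `s i` at `x i` where the sign is `+1`
(`ε i = true`) and at least `α / 2` below `s i` at `x i` where the sign is `-1`. -/
def Shatters {X : Type*} (G : Set (X → ℝ)) (α : ℝ) {d : ℕ} (x : Fin d → X) (s : Fin d → ℝ) :
    Prop :=
  ∀ ε : Fin d → Bool, ∃ g ∈ G, ∀ i,
    α / 2 ≤ (if ε i then (1 : ℝ) else -1) * (g (x i) - s i)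

/-- The `α`-fat-shattering dimension of a class `G` of `[0,1]`-valued functions: the largest `d`
such that some `d` points are `α`-shattered with a `[0,1]`-valued witness, and `⊤` if there are
arbitrarily large such `d`. -/
noncomputable def fatDim {X : Type*} (α : ℝ) (G : Set (X → ℝ)) : ℕ∞ :=
  ⨆ d ∈ {d : ℕ | ∃ (x : Fin d → X) (s : Fin d → ℝ),
    (∀ i, s i ∈ Set.Icc (0 : ℝ) 1) ∧ Shatters G α x s}, (d : ℕ∞)

/-- The class `{x ↦ ℓ(x, f) : f ∈ F}` of a game with loss `ℓ`. -/
def lossClass {X F : Type*} (ℓ : X → F → ℝ) : Set (X → ℝ) :=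
  Set.range fun f : F => fun x : X => ℓ x f

/-- A Glivenko–Cantelli game: the class of the game has finite fat-shattering dimension at every
scale. -/
def IsGCGame {X F : Type*} (ℓ : X → F → ℝ) : Prop :=
  ∀ α : ℝ, 0 < α → fatDim α (lossClass ℓ) < ⊤

/-- `G` contains infinitely many ordered thresholds with margin `α` and tightness `β`
(where `α > 2 * β > 0`). -/
def ContainsInfOrderedThresholds {X : Type*} (G : Set (X → ℝ)) (α β : ℝ) : Prop :=
  ∃ (x : ℕ → X) (f : ℕ → X → ℝ) (u u' : ℝ), (∀ i, f i ∈ G) ∧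
    u ∈ Set.Icc (0 : ℝ) 1 ∧ u' ∈ Set.Icc (0 : ℝ) 1 ∧
    α ≤ |u - u'| ∧
    (∀ i j, i ≤ j → |f i (x j) - u| ≤ β) ∧
    (∀ i j, j < i → |f i (x j) - u'| ≤ β) ∧
    u < u'

/-- The expected loss `𝔼_{(x, f) ∼ P × Q} ℓ(x, f)`. -/
noncomputable def expectedLoss {X F : Type*} [MeasurableSpace X] [MeasurableSpace F]
    (ℓ : X → F → ℝ) (P : ProbabilityMeasure X) (Q : ProbabilityMeasure F) : ℝ :=
  ∫ z : X × F, ℓ z.1 z.2 ∂((P : Measure X).prod (Q : Measure F))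

/-- `inf_P sup_Q 𝔼_{P × Q} ℓ`, over all probability measures. -/
noncomputable def upperValue {X F : Type*} [MeasurableSpace X] [MeasurableSpace F]
    (ℓ : X → F → ℝ) : ℝ :=
  ⨅ P : ProbabilityMeasure X, ⨆ Q : ProbabilityMeasure F, expectedLoss ℓ P Q

/-- `sup_Q inf_P 𝔼_{P × Q} ℓ`, over all probability measures. -/
noncomputable def lowerValue {X F : Type*} [MeasurableSpace X] [MeasurableSpace F]
    (ℓ : X → F → ℝ) : ℝ :=
  ⨆ Q : ProbabilityMeasure F, ⨅ P : ProbabilityMeasure X, expectedLoss ℓ P Q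

/-- The loss of the subgame on `X' ⊆ X` and `F' ⊆ F`; both subsets carry the trace σ-algebras. -/
def subgame {X F : Type*} (ℓ : X → F → ℝ) (X' : Set X) (F' : Set F) : X' → F' → ℝ :=
  fun x f => ℓ x f

end MinimaxGame

open Filter Topology

/-! ### Ordered thresholds from unequal iterated limits. -/

namespace MinimaxGame

/-! Thresholds break minimax on the subgame they span: far out in the sequence of the `f i` every `x
j` pays about `u'`, far out in that of the `x j` every `f i` earns about `u`, and dominated
convergence carries this over to mixed strategies. The values then differ by at least `α - 2β > 0`.

Conversely, let `c < c'` lie strictly between the two values. Finite minimax gives each player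
finitely supported strategies holding the loss below `c`, resp. above `c'`, against any finite set
of pure opponents, and a closing-off argument reduces to countable `S`, `T`. The loss maps `S` into
the cube `[0,1]^T` and `T` into `[0,1]^S`; in these compact metrizable cubes the strategies have
weak limits `μ`, `ν`. The loss need not extend jointly continuously. Its upper envelope (approach
`k` first through `S`) has integral at least `c'` against `μ × ν`, and its lower envelope (approach
`l` first through `T`) at most `c`. So at some `(k, l)` the upper envelope exceeds the lower one,
which yields sequences whose iterated limits satisfy `u < u'`, as in Grothendieck's double limit
criterion. A greedy choice of indices turns them into thresholds of margin `u' - u` and any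
tightness. The core is `exists_iterated_limits`, with `exists_mixed_lt_of_forall_mixed_exists_lt`
and `exists_ordered_thresholds_of_iterated_limits` at its two ends. -/

/-- Two sequences along which the iterated limits of `t` are `u` and `u'` contain, up to any
tightness, infinitely many ordered thresholds. -/
lemma exists_ordered_thresholds_of_iterated_limits {t : ℕ → ℕ → ℝ} {r s : ℕ → ℝ} {u u' β : ℝ}
    (hβ : 0 < β)
    (hr : ∀ m, Tendsto (fun n => t n m) atTop (𝓝 (r m))) (hru : Tendsto r atTop (𝓝 u))
    (hs : ∀ n, Tendsto (fun m => t n m) atTop (𝓝 (s n))) (hsu : Tendsto s atTop (𝓝 u')) :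
    ∃ x f : ℕ → ℕ, (∀ i j, i ≤ j → |t (x j) (f i) - u| ≤ β) ∧
      (∀ i j, j < i → |t (x j) (f i) - u'| ≤ β) := by
  have h1 : ∀ᶠ m in atTop, ∀ᶠ n in atTop, |t n m - u| < β := by
    filter_upwards [hru.eventually (Metric.ball_mem_nhds u hβ)] with m hm
    exact (hr m).eventually (Metric.isOpen_ball.mem_nhds hm)
  have h2 : ∀ᶠ n in atTop, ∀ᶠ m in atTop, |t n m - u'| < β := by
    filter_upwards [hsu.eventually (Metric.ball_mem_nhds u' hβ)] with n hn
    exact (hs n).eventually (Metric.isOpen_ball.mem_nhds hn)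
  -- Pairs `(m, n)` are picked greedily, `m` before `n`, so that `n` can also be taken large enough
  -- for the diagonal entry, which belongs to the `u` side.
  obtain ⟨g, hg, hgr⟩ := exists_seq_of_forall_finset_exists
    (fun z : ℕ × ℕ => (∀ᶠ n in atTop, |t n z.1 - u| < β) ∧ (∀ᶠ m in atTop, |t z.2 m - u'| < β) ∧
      |t z.2 z.1 - u| < β)
    (fun z w : ℕ × ℕ => |t w.2 z.1 - u| < β ∧ |t z.2 w.1 - u'| < β) (by
      intro S hS
      obtain ⟨m, hm, hmS⟩ := (h1.and ((Finset.eventually_all S).2 fun z hz => (hS z hz).2.1)).exists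
      obtain ⟨n, ⟨hn, hnm⟩, hnS⟩ :=
        ((h2.and hm).and ((Finset.eventually_all S).2 fun z hz => (hS z hz).1)).exists
      exact ⟨(m, n), ⟨hm, hn, hnm⟩, fun z hz => ⟨hnS z hz, hmS z hz⟩⟩)
  refine ⟨fun j => (g j).2, fun i => (g i).1, fun i j hij => ?_, fun i j hij => ?_⟩
  · rcases hij.eq_or_lt with rfl | h
    · exact (hg i).2.2.le
    · exact (hgr i j h).1.le
  · exact (hgr j i hij).2.le

/-! ### Finite minimax and reduction to countable strategy sets. -/

section FiniteMinimax

variable {X F : Type*}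

/-- Minimax theorem for a game in which one player has finitely many pure strategies. -/
lemma exists_mixed_lt_of_forall_mixed_exists_lt [Nonempty X] (ℓ : X → F → ℝ) (B : Finset F) (c : ℝ)
    (h : ∀ q : B → ℝ, (∀ f, 0 ≤ q f) → ∑ f, q f = 1 → ∃ x, ∑ f : B, q f * ℓ x f < c) :
    ∃ (A : Finset X) (w : A → ℝ), (∀ x, 0 ≤ w x) ∧ ∑ x, w x = 1 ∧
      ∀ f ∈ B, ∑ x : A, w x * ℓ x f < c := by
  classical
  let v : X → B → ℝ := fun x f => ℓ x f
  by_cases hne : (convexHull ℝ (Set.range v) ∩ {y | ∀ f, y f < c}).Nonempty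
  · obtain ⟨y, hy, hyc⟩ := hne
    rw [convexHull_range_eq_exists_affineCombination] at hy
    obtain ⟨A, w, hw0, hw1, rfl⟩ := hy
    refine ⟨A, fun x => w x, fun x => hw0 x x.2, by rwa [Finset.sum_coe_sort A w], fun f hf => ?_⟩
    have := hyc ⟨f, hf⟩
    rw [Finset.affineCombination_eq_linear_combination _ _ _ hw1] at this
    rw [Finset.sum_coe_sort A fun x => w x * ℓ x f]
    simpa [v, Finset.sum_apply] using this
  · exfalso
    have hopen : IsOpen {y : B → ℝ | ∀ f, y f < c} := by
      rw [Set.ofPred_forall]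
      exact isOpen_iInter_of_finite fun f => isOpen_lt (continuous_apply f) continuous_const
    have hconv : Convex ℝ {y : B → ℝ | ∀ f, y f < c} := by
      rw [Set.ofPred_forall]
      exact convex_iInter fun f =>
        convex_halfSpace_lt (f := fun y : B → ℝ => y f) ⟨fun _ _ => rfl, fun _ _ => rfl⟩ c
    obtain ⟨φ, s, hφ1, hφ2⟩ := geometric_hahn_banach_open hconv hopen (convex_convexHull ℝ _)
      ((Set.disjoint_iff_inter_eq_empty.2 (Set.not_nonempty_iff_eq_empty.1 hne)).symm)
    let q : B → ℝ := fun f => φ (Pi.single f 1)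
    have hφ : ∀ y, φ y = ∑ f, q f * y f := by
      intro y
      conv_lhs => rw [← Finset.univ_sum_single y, map_sum]
      refine Finset.sum_congr rfl fun f _ => ?_
      have : (Pi.single f (y f) : B → ℝ) = y f • Pi.single f 1 := by
        rw [← Pi.single_smul]; simp
      rw [this, map_smul, smul_eq_mul, mul_comm]
    -- The orthant is unbounded in the direction `-e_f`, so a negative coefficient would push `φ`
    -- past `s` on it.
    have hq : ∀ f, 0 ≤ q f := by
      intro f
      by_contra! hf
      obtain ⟨r, hr⟩ : ∃ r : ℝ, 0 ≤ r ∧ s ≤ φ (fun _ => c - 1) - r * q f := by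
        refine ⟨max 0 ((φ (fun _ => c - 1) - s) / q f), le_max_left _ _, ?_⟩
        have := mul_le_mul_of_nonpos_right (le_max_right 0 ((φ (fun _ => c - 1) - s) / q f)) hf.le
        rw [div_mul_cancel₀ _ hf.ne] at this
        linarith
      have := hφ1 ((fun _ => c - 1) - r • Pi.single f 1) (fun g => by
        have : 0 ≤ (Pi.single f (1 : ℝ) : B → ℝ) g := by
          rw [Pi.single_apply]; split_ifs <;> norm_num
        simp only [Pi.sub_apply, Pi.smul_apply, smul_eq_mul]
        nlinarith [mul_nonneg hr.1 this])
      rw [map_sub, map_smul, smul_eq_mul] at this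
      exact absurd hr.2 (not_le.2 this)
    have hx : ∀ x, s ≤ ∑ f : B, q f * ℓ x f := fun x => by
      rw [← hφ (v x)]
      exact hφ2 _ (subset_convexHull ℝ _ ⟨x, rfl⟩)
    have hc : ∀ y < c, (∑ f, q f) * y < s := fun y hy => by
      rw [Finset.sum_mul, ← hφ fun _ => y]
      exact hφ1 _ fun _ => hy
    -- If `q` vanishes, separation reads `s ≤ 0 < s`; otherwise `q` normalizes to a mixed strategy
    -- contradicting `h`.
    rcases (Finset.sum_nonneg fun f _ => hq f : 0 ≤ ∑ f, q f).eq_or_lt with h0 | hpos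
    · have hq0 : ∀ f, q f = 0 := fun f =>
        (Finset.sum_eq_zero_iff_of_nonneg fun f _ => hq f).1 h0.symm f (Finset.mem_univ f)
      have h1 := hx (Classical.arbitrary X)
      have h2 := hc (c - 1) (by linarith)
      simp only [hq0, zero_mul, Finset.sum_const_zero] at h1 h2
      linarith
    · obtain ⟨x, hxc⟩ := h (fun f => q f / ∑ f, q f) (fun f => div_nonneg (hq f) hpos.le)
        (by rw [← Finset.sum_div, div_self hpos.ne'])
      obtain ⟨y, hy1, hy2⟩ := exists_between hxc
      have h1 := hx x
      have h2 := hc y hy2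
      have h3 : ∑ f : B, q f / (∑ f, q f) * ℓ x f = (∑ f : B, q f * ℓ x f) / ∑ f, q f := by
        rw [Finset.sum_div]
        exact Finset.sum_congr rfl fun f _ => by ring
      rw [h3, div_lt_iff₀ hpos] at hy1
      linarith

/-- Closing off countably many times under two operations turning finite sets into finite sets. -/
lemma exists_countable_closed (a : Finset F → Finset X) (b : Finset X → Finset F) :
    ∃ (S : Set X) (T : Set F), S.Countable ∧ T.Countable ∧
      (∀ B : Finset F, ↑B ⊆ T → ∃ B' : Finset F, B ⊆ B' ∧ ↑(a B') ⊆ S) ∧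
      (∀ A : Finset X, ↑A ⊆ S → ∃ A' : Finset X, A ⊆ A' ∧ ↑(b A') ⊆ T) := by
  classical
  -- Only whole stages are fed to `a` and `b`, hence the enlargements `B'` and `A'`; a strategy good
  -- against `B'` is good against `B`.
  let z : ℕ → Finset X × Finset F := fun n =>
    Nat.rec (∅, ∅) (fun _ z => (z.1 ∪ a z.2, z.2 ∪ b z.1)) n
  have hz1 : Monotone fun n => ((z n).1 : Set X) := monotone_nat_of_le_succ fun n => by
    simp [z]
  have hz2 : Monotone fun n => ((z n).2 : Set F) := monotone_nat_of_le_succ fun n => by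
    simp [z]
  refine ⟨⋃ n, (z n).1, ⋃ n, (z n).2, Set.countable_iUnion fun n => Finset.countable_toSet _,
    Set.countable_iUnion fun n => Finset.countable_toSet _, fun B hB => ?_, fun A hA => ?_⟩
  · obtain ⟨n, hn⟩ := hz2.directed_le.exists_mem_subset_of_finset_subset_biUnion hB
    refine ⟨(z n).2, by exact_mod_cast hn, fun x hx => Set.mem_iUnion.2 ⟨n + 1, ?_⟩⟩
    exact Finset.mem_coe.2 (Finset.mem_union_right _ hx)
  · obtain ⟨n, hn⟩ := hz1.directed_le.exists_mem_subset_of_finset_subset_biUnion hA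
    refine ⟨(z n).1, by exact_mod_cast hn, fun x hx => Set.mem_iUnion.2 ⟨n + 1, ?_⟩⟩
    exact Finset.mem_coe.2 (Finset.mem_union_right _ hx)

end FiniteMinimax

/-! ### Semicontinuous envelopes and weak limits on compact spaces. -/

section Compactification

variable {A B K L : Type*}

/-- The supremal convolution of `E` along `ξ : A → K` with `N` times the distance, truncated
from below at `-1`. -/
noncomputable def supConv [PseudoMetricSpace K] (ξ : A → K) (E : A → L → ℝ) (N : ℕ) (k : K)
    (l : L) : ℝ :=
  max (-1) (⨆ a, (E a l - N * dist (ξ a) k))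

section Basic

variable [PseudoMetricSpace K] {ξ : A → K} {E : A → L → ℝ}

lemma supConv_bddAbove (hE : ∀ a l, |E a l| ≤ 1) (N : ℕ) (k : K) (l : L) :
    BddAbove (Set.range fun a => E a l - N * dist (ξ a) k) := by
  refine ⟨1, ?_⟩
  rintro _ ⟨a, rfl⟩
  have := (abs_le.1 (hE a l)).2
  have : 0 ≤ (N : ℝ) * dist (ξ a) k := by positivity
  simp only
  linarith

lemma neg_one_le_supConv (N : ℕ) (k : K) (l : L) : -1 ≤ supConv ξ E N k l := le_max_left _ _

lemma supConv_le_one [Nonempty A] (hE : ∀ a l, |E a l| ≤ 1) (N : ℕ) (k : K) (l : L) :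
    supConv ξ E N k l ≤ 1 := by
  refine max_le (by norm_num) (ciSup_le fun a => ?_)
  have := (abs_le.1 (hE a l)).2
  have : 0 ≤ (N : ℝ) * dist (ξ a) k := by positivity
  linarith

lemma abs_supConv_le_one [Nonempty A] (hE : ∀ a l, |E a l| ≤ 1) (N : ℕ) (k : K) (l : L) :
    |supConv ξ E N k l| ≤ 1 :=
  abs_le.2 ⟨neg_one_le_supConv N k l, supConv_le_one hE N k l⟩

lemma sub_mul_dist_le_supConv (hE : ∀ a l, |E a l| ≤ 1) (N : ℕ) (k : K) (l : L) (a : A) :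
    E a l - N * dist (ξ a) k ≤ supConv ξ E N k l :=
  (le_ciSup (supConv_bddAbove hE N k l) a).trans (le_max_right _ _)

lemma le_supConv (hE : ∀ a l, |E a l| ≤ 1) (N : ℕ) (l : L) (a : A) :
    E a l ≤ supConv ξ E N (ξ a) l := by
  simpa using sub_mul_dist_le_supConv (ξ := ξ) hE N (ξ a) l a

lemma supConv_antitone [Nonempty A] (hE : ∀ a l, |E a l| ≤ 1) (k : K) (l : L) :
    Antitone fun N => supConv ξ E N k l := by
  intro M N hMN
  refine max_le_max le_rfl (ciSup_mono (supConv_bddAbove hE M k l) fun a => ?_)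
  gcongr

lemma supConv_le_add [Nonempty A] (hE : ∀ a l, |E a l| ≤ 1) (N : ℕ) (k k' : K) (l : L) :
    supConv ξ E N k l ≤ supConv ξ E N k' l + N * dist k k' := by
  have h0 : 0 ≤ (N : ℝ) * dist k k' := by positivity
  refine max_le (by linarith [neg_one_le_supConv (ξ := ξ) (E := E) N k' l]) (ciSup_le fun a => ?_)
  have h1 := sub_mul_dist_le_supConv (ξ := ξ) hE N k' l a
  have h2 : (N : ℝ) * dist (ξ a) k' ≤ N * (dist (ξ a) k + dist k k') := by
    gcongr
    exact dist_triangle _ _ _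
  linarith

lemma continuous_supConv [Nonempty A] (hE : ∀ a l, |E a l| ≤ 1) (N : ℕ) (l : L) :
    Continuous fun k => supConv ξ E N k l := by
  refine (LipschitzWith.of_dist_le_mul (K := (N : NNReal)) fun k k' => ?_).continuous
  rw [Real.dist_eq, abs_sub_le_iff]
  have h1 := supConv_le_add (ξ := ξ) hE N k k' l
  have h2 := supConv_le_add (ξ := ξ) hE N k' k l
  rw [dist_comm k' k] at h2
  simp only [NNReal.coe_natCast]
  constructor <;> linarith

lemma measurable_supConv [Countable A] [MeasurableSpace K] [OpensMeasurableSpace K]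
    [MeasurableSpace L] (hE : ∀ a, Measurable (E a)) (N : ℕ) :
    Measurable fun z : K × L => supConv ξ E N z.1 z.2 := by
  refine measurable_const.max (Measurable.iSup fun a => ?_)
  have h : Measurable fun k => dist (ξ a) k := (continuous_const.dist continuous_id).measurable
  exact ((hE a).comp measurable_snd).sub ((h.comp measurable_fst).const_mul _)

/-- If the supremal convolutions at `(k, l)` stay above `w > -1`, then some sequence converges
to `k` along which `E · l` converges to a limit that is at least `w`. -/
lemma exists_seq_of_forall_le_supConv [Nonempty A] (hE : ∀ a l, |E a l| ≤ 1) {k : K} {l : L}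
    {w : ℝ} (hw : -1 < w) (h : ∀ N, w ≤ supConv ξ E N k l) :
    ∃ (a : ℕ → A) (w' : ℝ), w ≤ w' ∧ Tendsto (fun n => ξ (a n)) atTop (𝓝 k) ∧
      Tendsto (fun n => E (a n) l) atTop (𝓝 w') := by
  have h1 : ∀ N : ℕ, ∃ a, w - 1 / ((N : ℝ) + 1) < E a l - (N + 1 : ℕ) * dist (ξ a) k := by
    intro N
    refine exists_lt_of_lt_ciSup ?_
    have h2 : w ≤ ⨆ a, (E a l - (N + 1 : ℕ) * dist (ξ a) k) :=
      (le_max_iff.1 (h (N + 1))).resolve_left (not_le.2 hw)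
    have : 0 < 1 / ((N : ℝ) + 1) := by positivity
    linarith
  choose a ha using h1
  have hlim : Tendsto (fun N : ℕ => 1 / ((N : ℝ) + 1)) atTop (𝓝 0) :=
    tendsto_one_div_add_atTop_nhds_zero_nat
  have hξ : Tendsto (fun n => ξ (a n)) atTop (𝓝 k) := by
    rw [tendsto_iff_dist_tendsto_zero]
    -- The constant 3 bounds `E - w + 1/(N+1)`, as `E ≤ 1`, `-w < 1` and the error is at most 1.
    refine squeeze_zero (fun _ => dist_nonneg) (fun N => ?_)
      (by simpa using hlim.const_mul 3 : Tendsto (fun N : ℕ => 3 * (1 / ((N : ℝ) + 1))) atTop (𝓝 0))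
    have h2 := ha N
    have h3 := (abs_le.1 (hE (a N) l)).2
    have hpos : (0 : ℝ) < N + 1 := by positivity
    have h4 : 1 / ((N : ℝ) + 1) ≤ 1 := by
      rw [div_le_one hpos]; linarith [Nat.cast_nonneg (α := ℝ) N]
    rw [mul_one_div, le_div_iff₀ hpos]
    push_cast at h2
    linarith
  obtain ⟨w', -, φ, hφ, hw'⟩ := (isCompact_Icc (a := (-1 : ℝ)) (b := 1)).tendsto_subseq
    (x := fun n => E (a n) l) fun n => abs_le.1 (hE _ _)
  refine ⟨a ∘ φ, w', ?_, hξ.comp hφ.tendsto_atTop, hw'⟩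
  have h5 : Tendsto (fun n => w - 1 / ((φ n : ℝ) + 1)) atTop (𝓝 (w - 0)) :=
    tendsto_const_nhds.sub (hlim.comp hφ.tendsto_atTop)
  rw [sub_zero] at h5
  refine le_of_tendsto_of_tendsto' h5 hw' fun n => ?_
  have : 0 ≤ ((φ n + 1 : ℕ) : ℝ) * dist (ξ (a (φ n))) k := by positivity
  have := ha (φ n)
  simp only [Function.comp]
  linarith

end Basic

variable [MetricSpace K] [CompactSpace K] [MeasurableSpace K] [BorelSpace K]

/-- If mixed strategies on the countable set `A` do well against all finite subsets of `B`, then a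
sequence of them does well in the limit and converges weakly to a measure on the compactification
that does well. -/
lemma exists_tendsto_map [Countable A] [Countable B] [Nonempty B] [MeasurableSpace A]
    [DiscreteMeasurableSpace A] (ξ : A → K) (G : B → C(K, ℝ)) (c : ℝ)
    (h : ∀ B' : Finset B, ∃ p : ProbabilityMeasure A,
      ∀ b ∈ B', c ≤ ∫ a, G b (ξ a) ∂(p : Measure A)) :
    ∃ (p : ℕ → ProbabilityMeasure A) (μ : ProbabilityMeasure K),
      Tendsto (fun n => (p n).map (f := ξ) (Measurable.of_discrete).aemeasurable) atTop (𝓝 μ) ∧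
      ∀ b, c ≤ ∫ k, G b k ∂(μ : Measure K) := by
  choose P hP using h
  obtain ⟨e, he⟩ := exists_surjective_nat B
  classical
  -- The strategy `p n` is good against the first `n` elements of `B`, so each `b` is handled by all
  -- but finitely many `p n`.
  let p : ℕ → ProbabilityMeasure A := fun n => P ((Finset.range n).image e)
  obtain ⟨μ, ψ, hψ, hμ⟩ := CompactSpace.tendsto_subseq
    fun n => (p n).map (f := ξ) (Measurable.of_discrete).aemeasurable
  refine ⟨p ∘ ψ, μ, hμ, fun b => ?_⟩
  have hlim := (ProbabilityMeasure.tendsto_iff_forall_integral_tendsto.1 hμ)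
    (BoundedContinuousFunction.mkOfCompact (G b))
  simp only [BoundedContinuousFunction.mkOfCompact_apply] at hlim
  refine ge_of_tendsto hlim ?_
  obtain ⟨m, rfl⟩ := he b
  filter_upwards [hψ.tendsto_atTop.eventually_gt_atTop m] with n hn
  simp only [Function.comp, ProbabilityMeasure.toMeasure_map]
  rw [integral_map (Measurable.of_discrete).aemeasurable (G _).continuous.aestronglyMeasurable]
  exact hP _ _ (Finset.mem_image_of_mem e (Finset.mem_range.2 hn))

variable [MeasurableSpace L]

/-- With `l` integrated out, the convolution is continuous in `k`, so weak convergence applies,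
which it would not for the envelope itself. On `ξ a` it dominates `E a`, so its integral against
every `p n` is at least `c`. -/
lemma le_integral_supConv [Countable A] [Nonempty A] [MeasurableSpace A]
    [DiscreteMeasurableSpace A] {ξ : A → K} {E : A → L → ℝ} {c : ℝ}
    (hE : ∀ a l, |E a l| ≤ 1) (hEm : ∀ a, Measurable (E a))
    {p : ℕ → ProbabilityMeasure A} {μ : ProbabilityMeasure K}
    (hp : Tendsto (fun n => (p n).map (f := ξ) (Measurable.of_discrete).aemeasurable) atTop (𝓝 μ))
    (ν : ProbabilityMeasure L) (hν : ∀ a, c ≤ ∫ l, E a l ∂(ν : Measure L)) (N : ℕ) :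
    c ≤ ∫ k, ∫ l, supConv ξ E N k l ∂(ν : Measure L) ∂(μ : Measure K) := by
  have hm := measurable_supConv (K := K) (ξ := ξ) hEm N
  have hmk : ∀ k, Measurable fun l => supConv ξ E N k l := fun k => hm.comp measurable_prodMk_left
  have hint : ∀ k, Integrable (fun l => supConv ξ E N k l) (ν : Measure L) := fun k =>
    Integrable.of_bound (hmk k).aestronglyMeasurable 1
      (Eventually.of_forall fun l => abs_supConv_le_one hE N k l)
  have hcont : Continuous fun k => ∫ l, supConv ξ E N k l ∂(ν : Measure L) :=
    continuous_of_dominated (bound := fun _ => 1) (fun k => (hmk k).aestronglyMeasurable)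
      (fun k => Eventually.of_forall fun l => abs_supConv_le_one hE N k l)
      (integrable_const _) (Eventually.of_forall fun l => continuous_supConv hE N l)
  have hlim := (ProbabilityMeasure.tendsto_iff_forall_integral_tendsto.1 hp)
    (BoundedContinuousFunction.mkOfCompact ⟨_, hcont⟩)
  refine ge_of_tendsto' hlim fun n => ?_
  simp only [BoundedContinuousFunction.mkOfCompact_apply, ContinuousMap.coe_mk,
    ProbabilityMeasure.toMeasure_map]
  rw [integral_map (Measurable.of_discrete).aemeasurable hcont.aestronglyMeasurable]
  have hc : ∀ a, c ≤ ∫ l, supConv ξ E N (ξ a) l ∂(ν : Measure L) := fun a =>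
    (hν a).trans (integral_mono (Integrable.of_bound (hEm a).aestronglyMeasurable 1
      (Eventually.of_forall fun l => hE a l)) (hint _) fun l => le_supConv hE N l a)
  have hb : ∀ a, |∫ l, supConv ξ E N (ξ a) l ∂(ν : Measure L)| ≤ 1 := fun a => by
    have := norm_integral_le_of_norm_le_const (μ := (ν : Measure L)) (C := 1)
      (Eventually.of_forall fun l => by
        rw [Real.norm_eq_abs]; exact abs_supConv_le_one (ξ := ξ) hE N (ξ a) l)
    simpa using this
  calc c = ∫ _, c ∂(p n : Measure A) := by simp
    _ ≤ _ := integral_mono (integrable_const _)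
      (Integrable.of_bound (Measurable.of_discrete).aestronglyMeasurable 1
        (Eventually.of_forall hb)) hc

variable [MetricSpace L] [CompactSpace L] [BorelSpace L]

/-- A gap between the two values of a game on countable sets yields a point of the product of the
compactifications at which the iterated limits of the loss differ. -/
theorem exists_iterated_limits [Countable A] [Countable B] [Nonempty A] [Nonempty B]
    [MeasurableSpace A] [DiscreteMeasurableSpace A] [MeasurableSpace B] [DiscreteMeasurableSpace B]
    (ξ : A → K) (φ : B → L) (E : A → C(L, ℝ)) (G : B → C(K, ℝ))
    (hE : ∀ a l, |E a l| ≤ 1) (hG : ∀ b k, |G b k| ≤ 1)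
    {c c' : ℝ} (hcc' : c < c')
    (hA : ∀ B' : Finset B, ∃ p : ProbabilityMeasure A,
      ∀ b ∈ B', ∫ a, G b (ξ a) ∂(p : Measure A) ≤ c)
    (hB : ∀ A' : Finset A, ∃ q : ProbabilityMeasure B,
      ∀ a ∈ A', c' ≤ ∫ b, E a (φ b) ∂(q : Measure B)) :
    ∃ (k : K) (l : L) (a : ℕ → A) (b : ℕ → B) (u u' : ℝ), u < u' ∧
      Tendsto (fun n => ξ (a n)) atTop (𝓝 k) ∧ Tendsto (fun n => φ (b n)) atTop (𝓝 l) ∧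
      Tendsto (fun n => E (a n) l) atTop (𝓝 u') ∧ Tendsto (fun n => G (b n) k) atTop (𝓝 u) := by
  obtain ⟨p, μ, hp, hμ⟩ := exists_tendsto_map ξ (fun b => -G b) (-c) (fun B' => by
    obtain ⟨p, hp⟩ := hA B'
    exact ⟨p, fun b hb => by
      simpa [integral_neg] using hp b hb⟩)
  obtain ⟨q, ν, hq, hν⟩ := exists_tendsto_map φ E c' hB
  have hG' : ∀ b k, |(-G b) k| ≤ 1 := fun b k => by simpa using hG b k
  -- As `N` grows, `g N` decreases to the upper envelope and `-h N` increases to the lower one, both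
  -- truncated.
  let g : ℕ → K × L → ℝ := fun N z => supConv ξ (fun a => E a) N z.1 z.2
  let h : ℕ → K × L → ℝ := fun N z => supConv φ (fun b => -G b) N z.2 z.1
  have hgm : ∀ N, Measurable (g N) := measurable_supConv fun a => (E a).continuous.measurable
  have hhm : ∀ N, Measurable (h N) := fun N =>
    (measurable_supConv (fun b => (-G b).continuous.measurable) N).comp measurable_swap
  have hg1 : ∀ N z, |g N z| ≤ 1 := fun N z => abs_supConv_le_one hE N z.1 z.2
  have hh1 : ∀ N z, |h N z| ≤ 1 := fun N z => abs_supConv_le_one hG' N z.2 z.1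
  let ρ : Measure (K × L) := (μ : Measure K).prod (ν : Measure L)
  have hgi : ∀ N, Integrable (g N) ρ := fun N =>
    Integrable.of_bound (hgm N).aestronglyMeasurable 1 (Eventually.of_forall (hg1 N))
  have hhi : ∀ N, Integrable (h N) ρ := fun N =>
    Integrable.of_bound (hhm N).aestronglyMeasurable 1 (Eventually.of_forall (hh1 N))
  have hgv : ∀ N, c' ≤ ∫ z, g N z ∂ρ := fun N => by
    rw [integral_prod _ (hgi N)]
    exact le_integral_supConv hE (fun a => (E a).continuous.measurable) hp ν hν N
  have hhv : ∀ N, -c ≤ ∫ z, h N z ∂ρ := fun N => by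
    rw [integral_prod_symm _ (hhi N)]
    exact le_integral_supConv hG' (fun b => (-G b).continuous.measurable) hq μ hμ N
  have hga : ∀ z, Antitone fun N => g N z := fun z => supConv_antitone hE z.1 z.2
  have hha : ∀ z, Antitone fun N => h N z := fun z => supConv_antitone hG' z.2 z.1
  have hgt : ∀ z, Tendsto (fun N => g N z) atTop (𝓝 (⨅ N, g N z)) := fun z =>
    tendsto_atTop_ciInf (hga z) ⟨-1, by rintro _ ⟨N, rfl⟩; exact (abs_le.1 (hg1 N z)).1⟩
  have hht : ∀ z, Tendsto (fun N => h N z) atTop (𝓝 (⨅ N, h N z)) := fun z =>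
    tendsto_atTop_ciInf (hha z) ⟨-1, by rintro _ ⟨N, rfl⟩; exact (abs_le.1 (hh1 N z)).1⟩
  have hgl : ∀ z N, (⨅ N, g N z) ≤ g N z := fun z N => (hga z).le_of_tendsto (hgt z) N
  have hhl : ∀ z N, (⨅ N, h N z) ≤ h N z := fun z N => (hha z).le_of_tendsto (hht z) N
  have hlim := tendsto_integral_of_dominated_convergence (μ := ρ)
    (F := fun N z => g N z + h N z) (f := fun z => (⨅ N, g N z) + ⨅ N, h N z) (fun _ => 2)
    (fun N => ((hgm N).add (hhm N)).aestronglyMeasurable) (integrable_const _)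
    (fun N => Eventually.of_forall fun z => (abs_add_le _ _).trans
      (by linarith [hg1 N z, hh1 N z]))
    (Eventually.of_forall fun z => (hgt z).add (hht z))
  have hge : c' - c ≤ ∫ z, ((⨅ N, g N z) + ⨅ N, h N z) ∂ρ := ge_of_tendsto' hlim fun N => by
    rw [integral_add (hgi N) (hhi N)]
    linarith [hgv N, hhv N]
  obtain ⟨z, hz⟩ : ∃ z, 0 < (⨅ N, g N z) + ⨅ N, h N z := by
    by_contra! hcon
    linarith [integral_nonpos (μ := ρ) hcon]
  -- Each infimum is at most 1 and their sum is positive, so neither sits at the truncation level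
  -- `-1`.
  have hgz := (hgl z 0).trans (abs_le.1 (hg1 0 z)).2
  have hhz := (hhl z 0).trans (abs_le.1 (hh1 0 z)).2
  obtain ⟨a, u', hu', ha, hau⟩ := exists_seq_of_forall_le_supConv (ξ := ξ) hE
    (by linarith : -1 < ⨅ N, g N z) (hgl z)
  obtain ⟨b, v, hv, hb, hbv⟩ := exists_seq_of_forall_le_supConv (ξ := φ) hG'
    (by linarith : -1 < ⨅ N, h N z) (hhl z)
  refine ⟨z.1, z.2, a, b, -v, u', by linarith, ha, hb, hau, ?_⟩
  simpa using hbv.neg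

end Compactification

/-! ### From a gap in values to ordered thresholds. -/

section Combinatorial

/-- A game on countable sets with a gap between its values has differing iterated limits. -/
lemma exists_iterated_limits_of_gap {A B : Type*} [Countable A] [Countable B] [Nonempty A]
    [Nonempty B] [MeasurableSpace A] [DiscreteMeasurableSpace A] [MeasurableSpace B]
    [DiscreteMeasurableSpace B] (ℓ : A → B → ℝ) (hℓ : ∀ a b, ℓ a b ∈ Set.Icc (0 : ℝ) 1)
    {c c' : ℝ} (hcc' : c < c')
    (hA : ∀ B' : Finset B, ∃ p : ProbabilityMeasure A,
      ∀ b ∈ B', ∫ a, ℓ a b ∂(p : Measure A) ≤ c)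
    (hB : ∀ A' : Finset A, ∃ q : ProbabilityMeasure B,
      ∀ a ∈ A', c' ≤ ∫ b, ℓ a b ∂(q : Measure B)) :
    ∃ (a : ℕ → A) (b : ℕ → B) (r s : ℕ → ℝ) (u u' : ℝ), u < u' ∧
      (∀ m, Tendsto (fun n => ℓ (a n) (b m)) atTop (𝓝 (r m))) ∧ Tendsto r atTop (𝓝 u) ∧
      (∀ n, Tendsto (fun m => ℓ (a n) (b m)) atTop (𝓝 (s n))) ∧ Tendsto s atTop (𝓝 u') := by
  let _ : MetricSpace (B → unitInterval) := TopologicalSpace.metrizableSpaceMetric _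
  let _ : MetricSpace (A → unitInterval) := TopologicalSpace.metrizableSpaceMetric _
  have habs : ∀ t : unitInterval, |(t : ℝ)| ≤ 1 := fun t => abs_le.2 ⟨by linarith [t.2.1], t.2.2⟩
  let ξ : A → B → unitInterval := fun a b => ⟨ℓ a b, hℓ a b⟩
  let φ : B → A → unitInterval := fun b a => ⟨ℓ a b, hℓ a b⟩
  -- Coordinate evaluations: `E a (φ b)` and `G b (ξ a)` are both `ℓ a b` by definition, so `hA` and
  -- `hB` apply verbatim, and convergence in a cube gives the inner limits.
  let E : A → C(A → unitInterval, ℝ) := fun a => ⟨fun l => l a, by fun_prop⟩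
  let G : B → C(B → unitInterval, ℝ) := fun b => ⟨fun k => k b, by fun_prop⟩
  obtain ⟨k, l, a, b, u, u', huu', ha, hb, hu', hu⟩ := exists_iterated_limits ξ φ E G
    (fun a l => habs (l a)) (fun b k => habs (k b)) hcc' hA hB
  exact ⟨a, b, fun m => G (b m) k, fun n => E (a n) l, u, u', huu',
    fun m => ((G (b m)).continuous.tendsto k).comp ha, hu,
    fun n => ((E (a n)).continuous.tendsto l).comp hb, hu'⟩

/-- A finitely supported probability measure with given weights. -/
lemma exists_probabilityMeasure_integral_eq {ι Y : Type*} [Fintype ι] [MeasurableSpace Y]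
    (z : ι → Y) (w : ι → ℝ) (hw : ∀ i, 0 ≤ w i) (hw1 : ∑ i, w i = 1) :
    ∃ p : ProbabilityMeasure Y, ∀ g : Y → ℝ, Measurable g →
      ∫ y, g y ∂(p : Measure Y) = ∑ i, w i * g (z i) := by
  let P : Measure Y := ∑ i, ENNReal.ofReal (w i) • Measure.dirac (z i)
  have hP : IsProbabilityMeasure P := ⟨by
    simp only [P, Measure.coe_finsetSum, Finset.sum_apply, Measure.smul_apply, measure_univ,
      smul_eq_mul, mul_one]
    rw [← ENNReal.ofReal_sum_of_nonneg fun i _ => hw i, hw1, ENNReal.ofReal_one]⟩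
  refine ⟨⟨P, hP⟩, fun g hg => ?_⟩
  simp only [ProbabilityMeasure.coe_mk, P]
  rw [integral_finsetSum_measure]
  · refine Finset.sum_congr rfl fun i _ => ?_
    rw [integral_smul_measure, integral_dirac' _ _ hg.stronglyMeasurable,
      ENNReal.toReal_ofReal (hw i), smul_eq_mul]
  · intro i _
    exact (integrable_dirac' hg.stronglyMeasurable (by simp)).smul_measure ENNReal.ofReal_ne_top

/-- If the mixed extension of a game with finitely supported strategies has a gap, then the game
contains infinitely many ordered thresholds with arbitrarily small tightness. -/
theorem exists_infOrderedThresholds_of_gap {X F : Type*} (ℓ : X → F → ℝ)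
    (hℓ : ∀ x f, ℓ x f ∈ Set.Icc (0 : ℝ) 1) {c c' : ℝ} (hcc' : c < c')
    (hX : ∀ B : Finset F, ∃ (A : Finset X) (w : A → ℝ), (∀ x, 0 ≤ w x) ∧ ∑ x, w x = 1 ∧
      ∀ f ∈ B, ∑ x : A, w x * ℓ x f < c)
    (hF : ∀ A : Finset X, ∃ (B : Finset F) (w : B → ℝ), (∀ f, 0 ≤ w f) ∧ ∑ f, w f = 1 ∧
      ∀ x ∈ A, c' < ∑ f : B, w f * ℓ x f) :
    ∃ α : ℝ, 0 < α ∧ ∀ β, 0 < β → ContainsInfOrderedThresholds (lossClass ℓ) α β := by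
  choose a wa ha0 ha1 hac using hX
  choose b wb hb0 hb1 hbc using hF
  obtain ⟨S, T, hS, hT, hST, hTS⟩ := exists_countable_closed a b
  have := hS.to_subtype
  have := hT.to_subtype
  let _ : MeasurableSpace S := ⊤
  let _ : MeasurableSpace T := ⊤
  have hA : ∀ B' : Finset T, ∃ p : ProbabilityMeasure S,
      ∀ f ∈ B', ∫ x : S, ℓ x f ∂(p : Measure S) ≤ c := by
    intro B'
    obtain ⟨B, hB, hBS⟩ := hST (B'.map (Function.Embedding.subtype _)) (by
      intro f; simp only [Finset.coe_map]; rintro ⟨f, -, rfl⟩; exact f.2)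
    obtain ⟨p, hp⟩ := exists_probabilityMeasure_integral_eq
      (fun x : a B => (⟨x, hBS x.2⟩ : S)) (wa B) (ha0 B) (ha1 B)
    refine ⟨p, fun f hf => ?_⟩
    rw [hp (fun x => ℓ x f) .of_discrete]
    exact (hac B f (hB (Finset.mem_map_of_mem _ hf))).le
  have hB : ∀ A' : Finset S, ∃ q : ProbabilityMeasure T,
      ∀ x ∈ A', c' ≤ ∫ f : T, ℓ x f ∂(q : Measure T) := by
    intro A'
    obtain ⟨A, hA, hAT⟩ := hTS (A'.map (Function.Embedding.subtype _)) (by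
      intro f; simp only [Finset.coe_map]; rintro ⟨f, -, rfl⟩; exact f.2)
    obtain ⟨q, hq⟩ := exists_probabilityMeasure_integral_eq
      (fun f : b A => (⟨f, hAT f.2⟩ : T)) (wb A) (hb0 A) (hb1 A)
    refine ⟨q, fun x hx => ?_⟩
    rw [hq (fun f => ℓ x f) .of_discrete]
    exact (hbc A x (hA (Finset.mem_map_of_mem _ hx))).le
  have hSne : Nonempty S := (hA ∅).elim fun p _ => p.nonempty
  have hTne : Nonempty T := (hB ∅).elim fun q _ => q.nonempty
  obtain ⟨x, f, r, s, u, u', huu', hr, hru, hs, hsu⟩ :=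
    exists_iterated_limits_of_gap (fun (x : S) (f : T) => ℓ x f) (fun x f => hℓ x f) hcc' hA hB
  refine ⟨u' - u, sub_pos.2 huu', fun β hβ => ?_⟩
  obtain ⟨i, j, h1, h2⟩ := exists_ordered_thresholds_of_iterated_limits hβ hr hru hs hsu
  have hIcc : ∀ m n, ℓ (x n) (f m) ∈ Set.Icc (0 : ℝ) 1 := fun m n => hℓ _ _
  refine ⟨fun n => x (i n), fun m y => ℓ y (f (j m)), u, u', fun m => ⟨f (j m), rfl⟩, ?_, ?_,
    ?_, h1, h2, huu'⟩
  · exact isClosed_Icc.mem_of_tendsto hru (Eventually.of_forall fun m =>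
      isClosed_Icc.mem_of_tendsto (hr m) (Eventually.of_forall fun n => hIcc m n))
  · exact isClosed_Icc.mem_of_tendsto hsu (Eventually.of_forall fun n =>
      isClosed_Icc.mem_of_tendsto (hs n) (Eventually.of_forall fun m => hIcc m n))
  · rw [abs_sub_comm]; exact le_abs_self _

end Combinatorial

/-! ### Values of the measurable game. -/

section Values

variable {X F : Type*} [MeasurableSpace X] [MeasurableSpace F] {ℓ : X → F → ℝ}

lemma integrable_loss (hℓ : ∀ x f, ℓ x f ∈ Set.Icc (0 : ℝ) 1)
    (hm : Measurable (Function.uncurry ℓ)) (ρ : Measure (X × F)) [IsFiniteMeasure ρ] :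
    Integrable (fun z : X × F => ℓ z.1 z.2) ρ :=
  Integrable.of_bound hm.aestronglyMeasurable 1 (Eventually.of_forall fun z => by
    rw [Real.norm_eq_abs, abs_of_nonneg (hℓ _ _).1]; exact (hℓ _ _).2)

lemma expectedLoss_mem (hℓ : ∀ x f, ℓ x f ∈ Set.Icc (0 : ℝ) 1)
    (hm : Measurable (Function.uncurry ℓ)) (P : ProbabilityMeasure X) (Q : ProbabilityMeasure F) :
    expectedLoss ℓ P Q ∈ Set.Icc (0 : ℝ) 1 := by
  refine ⟨integral_nonneg fun z => (hℓ _ _).1, ?_⟩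
  refine (integral_mono (integrable_loss hℓ hm _) (integrable_const 1)
    fun z => (hℓ _ _).2).trans ?_
  simp

lemma bddBelow_expectedLoss (hℓ : ∀ x f, ℓ x f ∈ Set.Icc (0 : ℝ) 1)
    (hm : Measurable (Function.uncurry ℓ)) (Q : ProbabilityMeasure F) :
    BddBelow (Set.range fun P => expectedLoss ℓ P Q) :=
  ⟨0, by rintro _ ⟨P, rfl⟩; exact (expectedLoss_mem hℓ hm P Q).1⟩

lemma bddAbove_expectedLoss (hℓ : ∀ x f, ℓ x f ∈ Set.Icc (0 : ℝ) 1)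
    (hm : Measurable (Function.uncurry ℓ)) (P : ProbabilityMeasure X) :
    BddAbove (Set.range fun Q => expectedLoss ℓ P Q) :=
  ⟨1, by rintro _ ⟨Q, rfl⟩; exact (expectedLoss_mem hℓ hm P Q).2⟩

lemma expectedLoss_eq_integral_left (hℓ : ∀ x f, ℓ x f ∈ Set.Icc (0 : ℝ) 1)
    (hm : Measurable (Function.uncurry ℓ)) (P : ProbabilityMeasure X) (Q : ProbabilityMeasure F) :
    expectedLoss ℓ P Q = ∫ x, ∫ f, ℓ x f ∂(Q : Measure F) ∂(P : Measure X) :=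
  integral_prod _ (integrable_loss hℓ hm _)

lemma expectedLoss_eq_integral_right (hℓ : ∀ x f, ℓ x f ∈ Set.Icc (0 : ℝ) 1)
    (hm : Measurable (Function.uncurry ℓ)) (P : ProbabilityMeasure X) (Q : ProbabilityMeasure F) :
    expectedLoss ℓ P Q = ∫ f, ∫ x, ℓ x f ∂(P : Measure X) ∂(Q : Measure F) :=
  integral_prod_symm _ (integrable_loss hℓ hm _)

instance nonempty_probabilityMeasure {Y : Type*} [MeasurableSpace Y] [Nonempty Y] :
    Nonempty (ProbabilityMeasure Y) :=
  ⟨diracProba (Classical.arbitrary Y)⟩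

lemma iInf_expectedLoss_le_lowerValue [Nonempty X] (hℓ : ∀ x f, ℓ x f ∈ Set.Icc (0 : ℝ) 1)
    (hm : Measurable (Function.uncurry ℓ)) (Q : ProbabilityMeasure F) :
    ⨅ P, expectedLoss ℓ P Q ≤ lowerValue ℓ := by
  refine le_ciSup (f := fun Q => ⨅ P, expectedLoss ℓ P Q) ⟨1, ?_⟩ Q
  rintro _ ⟨Q, rfl⟩
  exact (ciInf_le (bddBelow_expectedLoss hℓ hm Q) (Classical.arbitrary _)).trans
    (expectedLoss_mem hℓ hm _ Q).2

lemma upperValue_le_iSup_expectedLoss [Nonempty F] (hℓ : ∀ x f, ℓ x f ∈ Set.Icc (0 : ℝ) 1)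
    (hm : Measurable (Function.uncurry ℓ)) (P : ProbabilityMeasure X) :
    upperValue ℓ ≤ ⨆ Q, expectedLoss ℓ P Q := by
  refine ciInf_le (f := fun P => ⨆ Q, expectedLoss ℓ P Q) ⟨0, ?_⟩ P
  rintro _ ⟨P, rfl⟩
  exact (expectedLoss_mem hℓ hm P (Classical.arbitrary _)).1.trans
    (le_ciSup (bddAbove_expectedLoss hℓ hm P) _)

lemma lowerValue_le_upperValue [Nonempty X] [Nonempty F]
    (hℓ : ∀ x f, ℓ x f ∈ Set.Icc (0 : ℝ) 1)
    (hm : Measurable (Function.uncurry ℓ)) : lowerValue ℓ ≤ upperValue ℓ :=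
  ciSup_le fun Q => le_ciInf fun P => (ciInf_le (bddBelow_expectedLoss hℓ hm Q) P).trans
    (le_ciSup (bddAbove_expectedLoss hℓ hm P) Q)

/-- Some mixed `P` answers `q` with expected loss below `c`, and some pure `x` does no worse than
the average over `P`. This supplies the hypothesis of the finite minimax lemma. -/
lemma exists_weighted_lt_of_lowerValue_lt [Nonempty X]
    (hℓ : ∀ x f, ℓ x f ∈ Set.Icc (0 : ℝ) 1)
    (hm : Measurable (Function.uncurry ℓ)) {c : ℝ} (hc : lowerValue ℓ < c) {B : Finset F}
    (q : B → ℝ) (hq : ∀ f, 0 ≤ q f) (hq1 : ∑ f, q f = 1) : ∃ x, ∑ f : B, q f * ℓ x f < c := by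
  obtain ⟨Q, hQ⟩ := exists_probabilityMeasure_integral_eq (fun f : B => (f : F)) q hq hq1
  obtain ⟨P, hP⟩ := exists_lt_of_ciInf_lt ((iInf_expectedLoss_le_lowerValue hℓ hm Q).trans_lt hc)
  rw [expectedLoss_eq_integral_left hℓ hm] at hP
  obtain ⟨x, hx⟩ := exists_le_integral (μ := (P : Measure X))
    (f := fun x => ∫ f, ℓ x f ∂(Q : Measure F)) (integrable_loss hℓ hm _).integral_prod_left
  refine ⟨x, ?_⟩
  rw [← hQ _ hm.of_uncurry_left]
  exact hx.trans_lt hP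

lemma exists_lt_weighted_of_lt_upperValue [Nonempty F]
    (hℓ : ∀ x f, ℓ x f ∈ Set.Icc (0 : ℝ) 1)
    (hm : Measurable (Function.uncurry ℓ)) {c : ℝ} (hc : c < upperValue ℓ) {A : Finset X}
    (p : A → ℝ) (hp : ∀ x, 0 ≤ p x) (hp1 : ∑ x, p x = 1) : ∃ f, c < ∑ x : A, p x * ℓ x f := by
  obtain ⟨P, hP⟩ := exists_probabilityMeasure_integral_eq (fun x : A => (x : X)) p hp hp1
  obtain ⟨Q, hQ⟩ := exists_lt_of_lt_ciSup (hc.trans_le (upperValue_le_iSup_expectedLoss hℓ hm P))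
  rw [expectedLoss_eq_integral_right hℓ hm] at hQ
  obtain ⟨f, hf⟩ := exists_integral_le (μ := (Q : Measure F))
    (f := fun f => ∫ x, ℓ x f ∂(P : Measure X)) (integrable_loss hℓ hm _).integral_prod_right
  refine ⟨f, ?_⟩
  rw [← hP _ hm.of_uncurry_right]
  exact hQ.trans_le hf

/-- A game that violates the minimax theorem contains infinitely many ordered thresholds. -/
theorem exists_infOrderedThresholds_of_values_ne [Nonempty X] [Nonempty F]
    (hℓ : ∀ x f, ℓ x f ∈ Set.Icc (0 : ℝ) 1)
    (hm : Measurable (Function.uncurry ℓ)) (hne : upperValue ℓ ≠ lowerValue ℓ) :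
    ∃ α : ℝ, 0 < α ∧ ∀ β, 0 < β → ContainsInfOrderedThresholds (lossClass ℓ) α β := by
  obtain ⟨c, hc, hcu⟩ := exists_between ((lowerValue_le_upperValue hℓ hm).lt_of_ne' hne)
  obtain ⟨c', hcc', hc'⟩ := exists_between hcu
  refine exists_infOrderedThresholds_of_gap ℓ hℓ hcc' (fun B =>
    exists_mixed_lt_of_forall_mixed_exists_lt ℓ B c fun q hq hq1 =>
      exists_weighted_lt_of_lowerValue_lt hℓ hm hc q hq hq1) fun A => ?_
  -- The same finite minimax lemma with the players exchanged and the loss negated.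
  obtain ⟨B, w, hw, hw1, h⟩ := exists_mixed_lt_of_forall_mixed_exists_lt (fun f x => -ℓ x f) A (-c')
    fun p hp hp1 => by
      obtain ⟨f, hf⟩ := exists_lt_weighted_of_lt_upperValue hℓ hm hc' p hp hp1
      exact ⟨f, by simpa using hf⟩
  exact ⟨B, w, hw, hw1, fun x hx => by simpa using h x hx⟩

/-- Capping `h i` at `c` turns the eventual bound into pointwise convergence to `c`, so dominated
convergence applies; the index from which the bound holds may depend on `y`. -/
lemma le_of_forall_integral_le {Y : Type*} [MeasurableSpace Y] (P : Measure Y)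
    [IsProbabilityMeasure P] {h : ℕ → Y → ℝ} (hm : ∀ i, Measurable (h i))
    (h01 : ∀ i y, h i y ∈ Set.Icc (0 : ℝ) 1) {c C : ℝ} (hc : ∀ y, ∀ᶠ i in atTop, c ≤ h i y)
    (hC : ∀ i, ∫ y, h i y ∂P ≤ C) : c ≤ C := by
  have habs : ∀ i y, ‖min (h i y) c‖ ≤ 1 + |c| := fun i y => by
    rw [Real.norm_eq_abs, abs_le]
    have := h01 i y
    have := abs_nonneg c
    refine ⟨le_min (by linarith [this, (h01 i y).1]) (by linarith [neg_abs_le c]), ?_⟩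
    exact (min_le_left _ _).trans (by linarith [(h01 i y).2])
  have hlim := tendsto_integral_of_dominated_convergence (μ := P)
    (F := fun i y => min (h i y) c) (f := fun _ => c) (fun _ => 1 + |c|)
    (fun i => ((hm i).min measurable_const).aestronglyMeasurable) (integrable_const _)
    (fun i => Eventually.of_forall (habs i))
    (Eventually.of_forall fun y => tendsto_const_nhds.congr' (by
      filter_upwards [hc y] with i hi using (min_eq_right hi).symm))
  rw [integral_const, probReal_univ, one_smul] at hlim
  refine le_of_tendsto' hlim fun i => (integral_mono ?_ ?_ fun y => min_le_left _ _).trans (hC i)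
  · exact Integrable.of_bound ((hm i).min measurable_const).aestronglyMeasurable _
      (Eventually.of_forall (habs i))
  · exact Integrable.of_bound (hm i).aestronglyMeasurable 1 (Eventually.of_forall fun y => by
      rw [Real.norm_eq_abs, abs_of_nonneg (h01 i y).1]; exact (h01 i y).2)

/-- If some sequence of pure strategies of the maximizer eventually guarantees `c` at each point,
then the upper value is at least `c`. -/
lemma le_upperValue_of_eventually_le [Nonempty X]
    (hℓ : ∀ x f, ℓ x f ∈ Set.Icc (0 : ℝ) 1)
    (hm : Measurable (Function.uncurry ℓ)) {c : ℝ} (f : ℕ → F)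
    (hf : ∀ x, ∀ᶠ i in atTop, c ≤ ℓ x (f i)) : c ≤ upperValue ℓ := by
  refine le_ciInf fun P => le_of_forall_integral_le (P : Measure X) (h := fun i x => ℓ x (f i))
    (fun i => hm.of_uncurry_right) (fun i x => hℓ _ _) hf fun i => ?_
  refine le_trans (le_of_eq ?_)
    (le_ciSup (bddAbove_expectedLoss hℓ hm P) (diracProba (f i)))
  rw [expectedLoss_eq_integral_left hℓ hm]
  refine integral_congr_ae (Eventually.of_forall fun x => ?_)
  exact (integral_dirac' _ _ hm.of_uncurry_left.stronglyMeasurable).symm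

/-- If some sequence of pure strategies of the minimizer eventually guarantees `c` against each
pure strategy of the maximizer, then the lower value is at most `c`. -/
lemma lowerValue_le_of_eventually_le [Nonempty F]
    (hℓ : ∀ x f, ℓ x f ∈ Set.Icc (0 : ℝ) 1)
    (hm : Measurable (Function.uncurry ℓ)) {c : ℝ} (x : ℕ → X)
    (hx : ∀ f, ∀ᶠ j in atTop, ℓ (x j) f ≤ c) : lowerValue ℓ ≤ c := by
  refine ciSup_le fun Q => ?_
  have := le_of_forall_integral_le (Q : Measure F) (h := fun j f => 1 - ℓ (x j) f) (c := 1 - c)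
    (C := 1 - ⨅ P, expectedLoss ℓ P Q) (fun j => measurable_const.sub hm.of_uncurry_left)
    (fun j f => ⟨by linarith [(hℓ (x j) f).2], by linarith [(hℓ (x j) f).1]⟩)
    (fun f => (hx f).mono fun j hj => by linarith) fun j => by
      rw [integral_sub (integrable_const _) (Integrable.of_bound
        hm.of_uncurry_left.aestronglyMeasurable 1 (Eventually.of_forall fun f => by
          rw [Real.norm_eq_abs, abs_of_nonneg (hℓ _ _).1]; exact (hℓ _ _).2))]
      have h1 := ciInf_le (bddBelow_expectedLoss hℓ hm Q) (diracProba (x j))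
      have h2 : expectedLoss ℓ (diracProba (x j)) Q =
          ∫ f, ℓ (x j) f ∂(Q : Measure F) := by
        rw [expectedLoss_eq_integral_right hℓ hm]
        refine integral_congr_ae (Eventually.of_forall fun f => ?_)
        exact integral_dirac' _ _ hm.of_uncurry_right.stronglyMeasurable
      rw [h2] at h1
      rw [integral_const, probReal_univ, one_smul]
      linarith
  linarith

end Values

/-! ### The two directions of the equivalence. -/

/-- The game spanned by infinitely many ordered thresholds violates the minimax theorem. -/
theorem exists_subgame_values_ne {X F : Type*} [MeasurableSpace X] [MeasurableSpace F]
    {ℓ : X → F → ℝ} (hℓ : ∀ x f, ℓ x f ∈ Set.Icc (0 : ℝ) 1)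
    (hm : Measurable (Function.uncurry ℓ)) {α β : ℝ} (hαβ : 2 * β < α)
    (h : ContainsInfOrderedThresholds (lossClass ℓ) α β) :
    ∃ (X' : Set X) (F' : Set F), X'.Nonempty ∧ F'.Nonempty ∧
      upperValue (subgame ℓ X' F') ≠ lowerValue (subgame ℓ X' F') := by
  obtain ⟨x, g, u, u', hg, -, -, hα, h1, h2, huu'⟩ := h
  choose f hf using hg
  obtain rfl : g = fun i y => ℓ y (f i) := funext fun i => (hf i).symm
  have := (Set.range_nonempty x).to_subtype
  have := (Set.range_nonempty f).to_subtype
  refine ⟨Set.range x, Set.range f, Set.range_nonempty _, Set.range_nonempty _, ?_⟩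
  have hℓ' : ∀ y e, subgame ℓ (Set.range x) (Set.range f) y e ∈ Set.Icc (0 : ℝ) 1 :=
    fun y e => hℓ y e
  have hm' : Measurable (Function.uncurry (subgame ℓ (Set.range x) (Set.range f))) :=
    hm.comp (measurable_subtype_coe.prodMap measurable_subtype_coe)
  have hu : u' - β ≤ upperValue (subgame ℓ (Set.range x) (Set.range f)) :=
    le_upperValue_of_eventually_le hℓ' hm' (fun i => ⟨f i, i, rfl⟩) (by
      rintro ⟨_, j, rfl⟩
      filter_upwards [eventually_gt_atTop j] with i hi
      have := (abs_le.1 (h2 i j hi)).1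
      simp only [subgame]
      linarith)
  have hl : lowerValue (subgame ℓ (Set.range x) (Set.range f)) ≤ u + β :=
    lowerValue_le_of_eventually_le hℓ' hm' (fun j => ⟨x j, j, rfl⟩) (by
      rintro ⟨_, i, rfl⟩
      filter_upwards [eventually_ge_atTop i] with j hj
      have := (abs_le.1 (h1 i j hj)).2
      simp only [subgame]
      linarith)
  rw [abs_of_neg (sub_neg.2 huu')] at hα
  intro heq
  linarith

lemma ContainsInfOrderedThresholds.of_subgame {X F : Type*} {ℓ : X → F → ℝ} {X' : Set X}
    {F' : Set F} {α β : ℝ}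
    (h : ContainsInfOrderedThresholds (lossClass (subgame ℓ X' F')) α β) :
    ContainsInfOrderedThresholds (lossClass ℓ) α β := by
  obtain ⟨x, g, u, u', hg, hu, hu', hα, h1, h2, huu'⟩ := h
  choose f hf using hg
  obtain rfl : g = fun i y => subgame ℓ X' F' y (f i) := funext fun i => (hf i).symm
  exact ⟨fun j => x j, fun i y => ℓ y (f i), u, u', fun i => ⟨f i, rfl⟩, hu, hu', hα, h1, h2, huu'⟩

end MinimaxGame

/-- The minimax theorem holds for all subgames if and only if there are no infinite sequences of
ordered thresholds. The gap argument passes through weak limits of mixed strategies on compact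
cubes rather than through uniform convergence, so finiteness of the fat-shattering dimension is
not used. -/
theorem mainTheorem7 (C₀ : ℝ) (hC₀ : 2 < C₀)
    {X F : Type*} [MeasurableSpace X] [MeasurableSpace F] (ℓ₀ : X → F → ℝ)
    (hℓ₀_mem : ∀ x f, ℓ₀ x f ∈ Set.Icc (0 : ℝ) 1)
    (hℓ₀_meas : Measurable (Function.uncurry ℓ₀))
    (hGC : MinimaxGame.IsGCGame ℓ₀) :
    (∀ (X' : Set X) (F' : Set F), X'.Nonempty → F'.Nonempty →
      MinimaxGame.upperValue (MinimaxGame.subgame ℓ₀ X' F') =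
        MinimaxGame.lowerValue (MinimaxGame.subgame ℓ₀ X' F')) ↔
    (∀ α : ℝ, 0 < α →
      ¬ MinimaxGame.ContainsInfOrderedThresholds (MinimaxGame.lossClass ℓ₀) α (α / C₀)) := by
  have hC : 0 < C₀ := by linarith
  constructor
  · intro h α hα hcon
    -- This is where `C₀ > 2` matters: the bands around `u` and `u'` must be disjoint. The converse
    -- gives every positive tightness.
    have hαβ : 2 * (α / C₀) < α := by
      rw [mul_div_assoc', div_lt_iff₀ hC]
      nlinarith
    obtain ⟨X', F', hX, hF, hne⟩ :=
      MinimaxGame.exists_subgame_values_ne hℓ₀_mem hℓ₀_meas hαβ hcon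
    exact hne (h X' F' hX hF)
  · intro h X' F' hX hF
    by_contra hne
    have := hX.to_subtype
    have := hF.to_subtype
    obtain ⟨α, hα, hcon⟩ := MinimaxGame.exists_infOrderedThresholds_of_values_ne
      (ℓ := MinimaxGame.subgame ℓ₀ X' F') (fun x f => hℓ₀_mem x f)
      (hℓ₀_meas.comp (measurable_subtype_coe.prodMap measurable_subtype_coe)) hne
    exact h α hα (hcon _ (div_pos hα hC)).of_subgame
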